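/- **Setting.** Let $\mathcal X$ be a set of datasets with a neighbouring relation $\sim$ (for instance: adding or removing the data of one user). Let $U$ be a (possibly infinite) set of elements, and let every dataset $x$ have a histogram $h^x : U \to \mathbb N$ with at most $\bar d$ nonzero counts. Assume that for neighbours $x \sim x'$ the histograms $h^x, h^{x'}$ differ in at most $\Delta$ elements, and that $|h^x_a - h^{x'}_a| \le \tau$ for every element $a$, where $\Delta\in\mathbb N$ and $\tau > 0$. Let $\sigma > 0$, and let $\Phi$, $\phi$ be the standard normal distribution function and density. Let $\delta < \Delta$ (which holds for every $\delta \in (0,1)$ when $\Delta \ge 1$), and let $T > 0$ solve $$\delta = \Delta \left( 1 - \frac{\Phi\left( \frac{T}{\tau\sigma} \right) - \Phi\left( \frac{\tau-T}{\tau\sigma} \right)}{\Phi\left( \frac{T}{\tau\sigma} \right) - \Phi\left( \frac{-T}{\tau\sigma} \right)} \right).$$ **Truncated Gaussian.** $\mathrm{TruncNormal}_T(\mu, s^2)$ is the law on $\mathbb R$ with density $\frac1s\,\phi\left(\frac{z-\mu}{s}\right) / \left(\Phi\left(\frac{T}{s}\right) - \Phi\left(\frac{-T}{s}\right)\right)$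 for $\mu - T \le z \le \mu + T$, and density $0$ otherwise. **Mechanism $\mathrm{TruncGauss}^{\Delta,\bar d,\tau}$.** On a histogram $h$ it sorts the counts, $h_{(1)} \ge h_{(2)} \ge \dots \ge h_{(\bar d)}$ (padded with zeros that carry no element), where $a_{(i)}$ is the element with the $i$-th largest count; it draws $v_i \sim \mathrm{TruncNormal}_T(h_{(i)}, \tau^2\sigma^2)$ independently for $i \le \bar d$, and it returns the set $S = \{(a_{(i)}, v_i) : v_i > \tau + T\}$ of elements with their noisy counts. (A zero count gives $v_i \le T$, so it is never returned.) **Privacy notion.** For $\alpha > 1$ let $D_\alpha(P\|Q) = \frac{1}{\alpha-1} \log \mathbb E_{z\sim P}\left[ \left(\frac{dP}{dQ}(z)\right)^{\alpha-1}\right]$ if $P \ll Q$, and $D_\alpha(P\|Q) = \infty$ otherwise. A randomized algorithm $M$ on $\mathcal X$ is $\delta$-approximately $(\xi,\rho)$-zCDP if for all neighbours $x \sim x'$ there are events $E$, $E'$ of positive probability over the randomness of $M(x)$ and of $M(x')$ respectively, with $\Pr[E], \Pr[E'] \ge 1-\delta$, such that for every $\alpha > 1$ $$D_\alpha(M(x)|_E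 \,\|\, M(x')|_{E'}) \le \alpha\rho + \xi \quad\text{and}\quad D_\alpha(M(x')|_{E'} \,\|\, M(x)|_{E}) \le \alpha\rho + \xi,$$ where $M(x)|_E$ is the distribution of the output $M(x)$ conditioned on $E$. **Lemma.** The algorithm $x \mapsto \mathrm{TruncGauss}^{\Delta,\bar d,\tau}(h^x)$ is $\delta$-approximately $\left(0, \frac{\Delta}{2\sigma^2}\right)$-zCDP. -/

import Mathlib

open MeasureTheory ProbabilityTheory
open scoped ENNReal

noncomputable section

/-! ### Rényi divergence and approximate zero-mean concentrated differential privacy -/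

/-- The Rényi divergence of order `α > 1`,
`D_α(P ‖ Q) = (α - 1)⁻¹ * log E_{z ∼ P} [(P(z) / Q(z)) ^ (α - 1)]`, as an extended real;
`P(z) / Q(z)` is the Radon-Nikodym derivative, and the divergence is `⊤` when `P` is not absolutely
continuous with respect to `Q`. -/
def renyiDiv {Y : Type*} [MeasurableSpace Y] (α : ℝ) (P Q : Measure Y) : EReal :=
  open Classical in
  if P ≪ Q then
    (((α - 1)⁻¹ : ℝ) : EReal) * ENNReal.log (∫⁻ z, (P.rnDeriv Q z) ^ (α - 1) ∂P)
  else ⊤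

/-- A randomized algorithm with inputs in `X` and outputs in `Y`: on input `x` it draws its
randomness `ω : Ω` from the probability measure `prob x`, and it returns `out x ω`. -/
structure RandomizedAlgorithm (X Ω Y : Type*) [MeasurableSpace Ω] [MeasurableSpace Y] where
  prob : X → Measure Ω
  isProbabilityMeasure_prob : ∀ x, IsProbabilityMeasure (prob x)
  out : X → Ω → Y
  measurable_out : ∀ x, Measurable (out x)

namespace RandomizedAlgorithm

variable {X Ω Y : Type*} [MeasurableSpace Ω] [MeasurableSpace Y]

/-- `M(x)|_E`: the distribution of the output `M(x)` conditioned on the event `E`. -/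
def condLaw (M : RandomizedAlgorithm X Ω Y) (x : X) (E : Set Ω) : Measure Y :=
  ((M.prob x)[|E]).map (M.out x)

/-- `M` run on the statistic `f(x)` of the dataset `x`. -/
def comp (M : RandomizedAlgorithm X Ω Y) {X' : Type*} (f : X' → X) :
    RandomizedAlgorithm X' Ω Y where
  prob x := M.prob (f x)
  isProbabilityMeasure_prob x := M.isProbabilityMeasure_prob (f x)
  out x := M.out (f x)
  measurable_out x := M.measurable_out (f x)

/-- `M` is `δ`-approximately `(ξ, ρ)`-zCDP with respect to the neighbouring relation `nbr`: for
neighbours `x, x'` there are events `E` (for the run on `x`) and `E'` (for the run on `x'`), of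
probability at least `1 - δ` each, such that the outputs conditioned on these events have Rényi
divergence at most `α * ρ + ξ` in both directions, for every order `α > 1`.
(The events have positive probability, so that the conditional distributions exist; this is
automatic for `δ < 1`.) -/
def IsApproxZCDP (M : RandomizedAlgorithm X Ω Y) (nbr : X → X → Prop) (δ ξ ρ : ℝ) : Prop :=
  ∀ x x' : X, nbr x x' → ∃ E E' : Set Ω,
    MeasurableSet E ∧ MeasurableSet E' ∧
    M.prob x E ≠ 0 ∧ M.prob x' E' ≠ 0 ∧
    ENNReal.ofReal (1 - δ) ≤ M.prob x E ∧ ENNReal.ofReal (1 - δ) ≤ M.prob x' E' ∧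
    ∀ α : ℝ, 1 < α →
      renyiDiv α (M.condLaw x E) (M.condLaw x' E') ≤ ((α * ρ + ξ : ℝ) : EReal) ∧
      renyiDiv α (M.condLaw x' E') (M.condLaw x E) ≤ ((α * ρ + ξ : ℝ) : EReal)

end RandomizedAlgorithm

/-! ### The symmetric truncated Gaussian -/

/-- The standard normal density `φ`. -/
def stdNormalPDF (z : ℝ) : ℝ := gaussianPDFReal 0 1 z

/-- The standard normal distribution function `Φ`. -/
def stdNormalCDF (z : ℝ) : ℝ := cdf (gaussianReal 0 1) z

/-- The density of the Gaussian with mean `μ` and standard deviation `s`, truncated to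
`[μ - T, μ + T]`. -/
def truncNormalPDF (T μ s z : ℝ) : ℝ :=
  open Classical in
  if μ - T ≤ z ∧ z ≤ μ + T then
    1 / s * (stdNormalPDF ((z - μ) / s) / (stdNormalCDF (T / s) - stdNormalCDF (-T / s)))
  else 0

/-- The truncated Gaussian with truncation value `T`, mean `μ` and standard deviation `s`. -/
def truncNormal (T μ s : ℝ) : Measure ℝ :=
  volume.withDensity fun z => ENNReal.ofReal (truncNormalPDF T μ s z)

theorem stdNormalCDF_sub {a b : ℝ} (hab : a ≤ b) :
    gaussianReal 0 1 (Set.Icc a b) = ENNReal.ofReal (stdNormalCDF b - stdNormalCDF a) := by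
  have : NullSingletonClass (gaussianReal 0 1) := nullSingletonClass_gaussianReal (by simp)
  rw [← measure_congr (Ioc_ae_eq_Icc (a := a) (b := b))]
  conv_lhs => rw [← measure_cdf (gaussianReal 0 1)]
  rw [StieltjesFunction.measure_Ioc]
  rfl

theorem stdNormalCDF_lt {a b : ℝ} (hab : a < b) : stdNormalCDF a < stdNormalCDF b := by
  have h1 : 0 < gaussianReal 0 1 (Set.Icc a b) := by
    rw [pos_iff_ne_zero]
    intro h0
    have h2 := gaussianReal_absolutelyContinuous' 0 (v := 1) (by simp) h0
    rw [Real.volume_Icc] at h2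
    simp at h2
    linarith
  rw [stdNormalCDF_sub hab.le] at h1
  have := ENNReal.ofReal_pos.mp h1
  linarith

theorem isProbabilityMeasure_truncNormal {T s : ℝ} (hT : 0 < T) (hs : 0 < s) (μ : ℝ) :
    IsProbabilityMeasure (truncNormal T μ s) := by
  constructor
  have hlt : -T / s < T / s := by
    rw [div_lt_div_iff_of_pos_right hs]; linarith
  set c := stdNormalCDF (T / s) - stdNormalCDF (-T / s) with hc
  have hcpos : 0 < c := sub_pos.mpr (stdNormalCDF_lt hlt)
  have hpdf : ∀ z, ENNReal.ofReal (truncNormalPDF T μ s z) =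
      (ENNReal.ofReal c⁻¹) * (Set.Icc (μ - T) (μ + T)).indicator
        (gaussianPDF μ (.mk (s ^ 2) (sq_nonneg _))) z := by
    intro z
    unfold truncNormalPDF
    by_cases hz : μ - T ≤ z ∧ z ≤ μ + T
    · rw [if_pos hz, Set.indicator_of_mem (show z ∈ Set.Icc _ _ from hz), gaussianPDF,
        ← ENNReal.ofReal_mul (by positivity)]
      congr 1
      have hs0 : s ≠ 0 := hs.ne'
      simp only [stdNormalPDF, gaussianPDFReal]
      have hsq : Real.sqrt (2 * Real.pi * s ^ 2) = Real.sqrt (2 * Real.pi) * s := by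
        rw [Real.sqrt_mul (by positivity), Real.sqrt_sq hs.le]
      simp only [NNReal.coe_mk, NNReal.coe_one, hsq, mul_one, ← hc]
      have he : -((z - μ) / s - 0) ^ 2 / 2 = -(z - μ) ^ 2 / (2 * s ^ 2) := by
        field_simp
        ring
      rw [he]
      field_simp
    · rw [if_neg hz, Set.indicator_of_notMem (show z ∉ Set.Icc _ _ from hz)]
      simp
  have hmap : gaussianReal μ (.mk (s ^ 2) (sq_nonneg _)) (Set.Icc (μ - T) (μ + T))
      = gaussianReal 0 1 (Set.Icc (-T / s) (T / s)) := by
    have h1 : gaussianReal μ (.mk (s ^ 2) (sq_nonneg _)) =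
        (gaussianReal 0 1).map (fun z => s * z + μ) := by
      have := gaussianReal_map_const_mul (μ := 0) (v := 1) s
      rw [show (fun z : ℝ => s * z + μ) = (fun z => z + μ) ∘ (fun z => s * z) from rfl,
        ← Measure.map_map (by fun_prop) (by fun_prop), this, gaussianReal_map_add_const]
      simp
    rw [h1, Measure.map_apply (by fun_prop) measurableSet_Icc]
    congr 1
    ext z
    simp only [Set.mem_preimage, Set.mem_Icc, div_le_iff₀ hs, le_div_iff₀ hs]
    constructor <;> rintro ⟨h, h'⟩ <;> constructor <;> nlinarith
  have hs2 : (NNReal.mk (s ^ 2) (sq_nonneg _)) ≠ 0 := by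
    intro h
    have := congrArg NNReal.toReal h
    simp at this
    exact hs.ne' this
  rw [truncNormal, withDensity_apply _ MeasurableSet.univ, Measure.restrict_univ]
  simp_rw [hpdf]
  rw [lintegral_const_mul _ ((measurable_gaussianPDF _ _).indicator measurableSet_Icc),
    lintegral_indicator measurableSet_Icc, ← gaussianReal_apply _ hs2, hmap,
    stdNormalCDF_sub hlt.le, ← hc, ← ENNReal.ofReal_mul (by positivity),
    inv_mul_cancel₀ hcpos.ne', ENNReal.ofReal_one]

/-! ### The truncated Gaussian mechanism over an unknown domain -/

/-- A released set of pairs (element, noisy count). It is a structure of its own because the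
σ-algebra needed here is not the cylinder σ-algebra that `Finset` carries. -/
@[ext] structure Release (U : Type*) where
  entries : Finset (U × ℝ)

/-- The σ-algebra generated by the events "an entry of `S` has the element `a` and a noisy count
in `B`", for elements `a` and Borel sets `B`. -/
instance Release.instMeasurableSpace (U : Type*) : MeasurableSpace (Release U) :=
  MeasurableSpace.generateFrom
    {A | ∃ (a : U) (B : Set ℝ), MeasurableSet B ∧ A = {S | ∃ r ∈ B, (a, r) ∈ S.entries}}

namespace TruncGauss

variable {U : Type*}

/-- The elements of a histogram with nonzero count, sorted by decreasing count (ties are broken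
in an arbitrary fixed way). -/
def sortedElements (h : U →₀ ℕ) : List U :=
  h.support.toList.mergeSort fun a b => decide (h b ≤ h a)

/-- The `i`-th largest count `h_(i)` (counted from `0`); it is `0` beyond the support of `h`. -/
def sortedCount (h : U →₀ ℕ) (i : ℕ) : ℕ :=
  match (sortedElements h)[i]? with
  | some a => h a
  | none => 0

/-- The returned set: the pairs of the `i`-th element and its noisy count `v i`, for those `i`
with `v i > τ + T`. Ranks `i` beyond the support of `h` have count `0` and carry no element: as
their noisy count is at most `T` they contribute nothing. -/
def release (dbar : ℕ) (τ T : ℝ) (h : U →₀ ℕ) (v : Fin dbar → ℝ) : Release U :=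
  open Classical in
  ⟨Finset.univ.biUnion fun i : Fin dbar =>
    match (sortedElements h)[(i : ℕ)]? with
    | some a => if v i > τ + T then {(a, v i)} else ∅
    | none => ∅⟩

theorem measurable_release (dbar : ℕ) (τ T : ℝ) (h : U →₀ ℕ) :
    Measurable (release dbar τ T h) := by
  classical
  refine measurable_generateFrom ?_
  rintro A ⟨a, B, hB, rfl⟩
  have : release dbar τ T h ⁻¹' {S | ∃ r ∈ B, (a, r) ∈ S.entries} =
      ⋃ i : Fin dbar, ⋃ _ : (sortedElements h)[(i : ℕ)]? = some a,
        (fun v : Fin dbar → ℝ => v i) ⁻¹' (B ∩ Set.Ioi (τ + T)) := by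
    ext v
    simp only [release, Set.mem_preimage, Set.mem_ofPred_eq, Finset.mem_biUnion, Finset.mem_univ,
      true_and, Set.mem_iUnion, exists_prop, Set.mem_inter_iff, Set.mem_Ioi]
    constructor
    · rintro ⟨r, hr, i, hi⟩
      refine ⟨i, ?_⟩
      split at hi
      · rename_i b hb
        split_ifs at hi with hv
        · simp only [Finset.mem_singleton, Prod.mk.injEq] at hi
          obtain ⟨rfl, rfl⟩ := hi
          exact ⟨hb, hr, hv⟩
        · simp at hi
      · simp at hi
    · rintro ⟨i, hi, hvB, hv⟩
      refine ⟨v i, hvB, i, ?_⟩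
      rw [hi]
      simp [hv]
  rw [this]
  exact MeasurableSet.iUnion fun i => MeasurableSet.iUnion fun _ =>
    measurable_pi_apply i (hB.inter measurableSet_Ioi)

/-- The mechanism `TruncGauss^{Δ, dbar, τ}` with truncation level `T`: it draws independent
`v_i ∼ TruncNormal_T(h_(i), τ² σ²)` for the `dbar` largest counts of the histogram `h`, and returns
the elements with noisy count above `τ + T`, together with these noisy counts. (The parameters `Δ`
and `δ` enter through `T`, see `IsTruncationLevel`.) -/
def mechanism (U : Type*) (dbar : ℕ) {τ σ T : ℝ} (hτ : 0 < τ) (hσ : 0 < σ) (hT : 0 < T) :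
    RandomizedAlgorithm (U →₀ ℕ) (Fin dbar → ℝ) (Release U) where
  prob h := Measure.pi fun i : Fin dbar => truncNormal T (sortedCount h i) (τ * σ)
  isProbabilityMeasure_prob h := by
    have : ∀ i : Fin dbar,
        IsProbabilityMeasure (truncNormal T (sortedCount h i) (τ * σ)) := fun i =>
      isProbabilityMeasure_truncNormal hT (mul_pos hτ hσ) _
    infer_instance
  out h := release dbar τ T h
  measurable_out h := measurable_release dbar τ T h

/-- `T` solves the equation that sets the truncation level. -/
def IsTruncationLevel (Δ : ℕ) (τ σ δ T : ℝ) : Prop :=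
  δ = Δ * (1 -
    (stdNormalCDF (T / (τ * σ)) - stdNormalCDF ((τ - T) / (τ * σ))) /
      (stdNormalCDF (T / (τ * σ)) - stdNormalCDF (-T / (τ * σ))))

end TruncGauss

/-! ### Sensitivity of a histogram -/

/-- On neighbouring datasets at most `Δ` counts of the histogram differ. -/
def HasL0Sensitivity {X U : Type*} (nbr : X → X → Prop) (hist : X → U →₀ ℕ) (Δ : ℕ) : Prop :=
  ∀ x x', nbr x x' → {a | hist x a ≠ hist x' a}.ncard ≤ Δ

/-- On neighbouring datasets every count of the histogram differs by at most `τ`. -/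
def HasLInftySensitivity {X U : Type*} (nbr : X → X → Prop) (hist : X → U →₀ ℕ) (τ : ℝ) : Prop :=
  ∀ x x', nbr x x' → ∀ a, |(hist x a : ℝ) - hist x' a| ≤ τ

end

noncomputable section

open scoped NNReal

/-! Let `h`, `k` be neighbouring histograms. In the run on `h`, condition on every noisy count lying
within `T` of both its true count and its partner count. The partner count is the count in `k` if
nonzero, and the true count otherwise, so elements missing from `k` are not constrained; their count
is at most `τ`, their noisy count at most `τ + T`, and they are never released. Symmetrically for
the run on `k`.

Under this conditioning both outputs are the same function (`releaseOn`) of independent Gaussians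
indexed by the common elements, conditioned on the same intervals `[max - T, min + T]`. The sorting
orders no longer matter. By data processing and independence the divergence is at most a sum of
one-dimensional terms. The means `p`, `q` are mirror images in the midpoint of the interval, so the
normalizing constants cancel. The Rényi moment is then the untruncated one times the ratio of the
interval's masses under means `α p + (1 - α) q` and `q`; the former mean is farther from the
midpoint, so the ratio is at most 1. At most `Δ` terms are nonzero, each at most `α τ² / (2 τ² σ²)`.

At most `Δ` coordinates are genuinely constrained, each satisfied with probability at least the
quotient `q` in the equation for `T`. Hence the event has probability at least `q ^ Δ ≥ 1 - Δ (1 -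
q) = 1 - δ` by Bernoulli's inequality. -/

/-! ### Data processing for Rényi moments. -/

/-- With `R` the density of the pushforwards, the left side is `∫ R ^ α` against `Q.map g`, which
equals `∫ f * (R ∘ g) ^ (α - 1)` against `Q`. Young's inequality bounds this by a convex combination
of the right side and of the left side itself, which is then absorbed. -/
theorem lintegral_rnDeriv_map_rpow_le {Z Y : Type*} [MeasurableSpace Z] [MeasurableSpace Y]
    {Q : Measure Z} [IsFiniteMeasure Q] {f : Z → ℝ≥0∞} (hf : Measurable f)
    [IsFiniteMeasure (Q.withDensity f)] {g : Z → Y} (hg : Measurable g) {α : ℝ} (hα : 1 < α) :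
    ∫⁻ z, (((Q.withDensity f).map g).rnDeriv (Q.map g) z) ^ (α - 1) ∂((Q.withDensity f).map g) ≤
      ∫⁻ z, f z ^ α ∂Q := by
  set P := Q.withDensity f with hP
  set R := (P.map g).rnDeriv (Q.map g) with hR
  have hRm : Measurable R := Measure.measurable_rnDeriv _ _
  have hac : P.map g ≪ Q.map g := (withDensity_absolutelyContinuous Q f).map hg
  have hPR : P.map g = (Q.map g).withDensity R := (Measure.withDensity_rnDeriv_eq _ _ hac).symm
  have key : ∀ F : Y → ℝ≥0∞, Measurable F →
      ∫⁻ z, F z ∂(P.map g) = ∫⁻ z, R z * F z ∂(Q.map g) := fun F hF => by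
    conv_lhs => rw [hPR]
    rw [lintegral_withDensity_eq_lintegral_mul _ hRm hF]
    rfl
  have hα0 : 0 < α := by linarith
  have hpq : α.HolderConjugate (α / (α - 1)) := Real.HolderConjugate.conjExponent hα
  -- Absorption needs a finite quantity to subtract, so `R` is truncated at `n`; monotone
  -- convergence removes the truncation.
  have bound : ∀ n : ℕ, ∫⁻ z, (min (R z) n) ^ α ∂(Q.map g) ≤ ∫⁻ z, f z ^ α ∂Q := by
    intro n
    have hm : Measurable fun z => min (R z) (n : ℝ≥0∞) := hRm.min measurable_const
    set A := ∫⁻ z, (min (R z) n) ^ α ∂(Q.map g) with hA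
    set B := ∫⁻ z, f z ^ α ∂Q
    have hAfin : A ≠ ∞ := by
      refine ne_top_of_le_ne_top ?_ (lintegral_mono (g := fun _ => (n : ℝ≥0∞) ^ α) fun z =>
        ENNReal.rpow_le_rpow (min_le_right _ _) hα0.le)
      rw [lintegral_const]
      exact ENNReal.mul_ne_top (ENNReal.rpow_ne_top_of_nonneg hα0.le (by simp))
        (measure_ne_top _ _)
    have h1 : A ≤ ∫⁻ z, (min (R z) n) ^ (α - 1) ∂(P.map g) := by
      rw [key _ (hm.pow_const _)]
      refine lintegral_mono fun z => ?_
      have : (min (R z) (n : ℝ≥0∞)) ^ α = min (R z) n * (min (R z) n) ^ (α - 1) := by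
        conv_rhs => enter [1]; rw [← ENNReal.rpow_one (min (R z) (n : ℝ≥0∞))]
        rw [← ENNReal.rpow_add_of_nonneg _ _ zero_le_one (by linarith)]
        ring_nf
      simp only [this]
      gcongr
      exact min_le_left _ _
    have h2 : ∫⁻ z, (min (R z) n) ^ (α - 1) ∂(P.map g) ≤
        B / ENNReal.ofReal α + A / ENNReal.ofReal (α / (α - 1)) := by
      rw [lintegral_map (hm.pow_const _) hg, hP,
        lintegral_withDensity_eq_lintegral_mul _ hf (by fun_prop), hA,
        lintegral_map (hm.pow_const _) hg]
      simp only [div_eq_mul_inv]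
      rw [← lintegral_mul_const _ (hf.pow_const _),
        ← lintegral_mul_const _ (by fun_prop), ← lintegral_add_left (by fun_prop)]
      refine lintegral_mono fun z => ?_
      have := ENNReal.young_inequality (f z) ((min (R (g z)) (n : ℝ≥0∞)) ^ (α - 1)) hpq
      rw [← ENNReal.rpow_mul, show (α - 1) * (α / (α - 1)) = α by
        field_simp [(by linarith : α - 1 ≠ 0)]] at this
      simpa [div_eq_mul_inv] using this
    have hsplit : A = A / ENNReal.ofReal α + A / ENNReal.ofReal (α / (α - 1)) := by
      rw [div_eq_mul_inv, div_eq_mul_inv, ← mul_add, hpq.inv_add_inv_ennreal, mul_one]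
    have h3 : A / ENNReal.ofReal α ≤ B / ENNReal.ofReal α := by
      refine (ENNReal.add_le_add_iff_right (a := A / ENNReal.ofReal (α / (α - 1))) ?_).mp ?_
      · exact ENNReal.div_ne_top hAfin (by simpa using div_pos hα0 (sub_pos.mpr hα))
      · rw [← hsplit]
        exact h1.trans h2
    rwa [ENNReal.div_le_iff_le_mul (by simp [hα0]) (by simp),
      ENNReal.div_mul_cancel (by simpa using hα0) (by simp)] at h3
  have hlim : Filter.Tendsto (fun n : ℕ => ∫⁻ z, (min (R z) n) ^ α ∂(Q.map g)) Filter.atTop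
      (nhds (∫⁻ z, R z ^ α ∂(Q.map g))) := by
    refine lintegral_tendsto_of_tendsto_of_monotone
      (fun n => ((hRm.min measurable_const).pow_const _).aemeasurable)
      (ae_of_all _ fun z m n hmn => ENNReal.rpow_le_rpow
        (min_le_min_left _ (by exact_mod_cast hmn)) hα0.le) (ae_of_all _ fun z => ?_)
    refine (ENNReal.continuous_rpow_const.tendsto _).comp ?_
    have := (tendsto_const_nhds (x := R z)).min ENNReal.tendsto_nat_nhds_top
    simpa using this
  rw [key _ (hRm.pow_const _)]
  refine le_trans (le_of_eq (lintegral_congr fun z => ?_)) (le_of_tendsto' hlim bound)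
  conv_lhs => enter [1]; rw [← ENNReal.rpow_one (R z)]
  rw [← ENNReal.rpow_add_of_nonneg _ _ zero_le_one (by linarith)]
  ring_nf

/-- Data processing, for a pair of measures with a known density. -/
theorem renyiDiv_map_withDensity_le {Z Y : Type*} [MeasurableSpace Z] [MeasurableSpace Y]
    {Q : Measure Z} [IsFiniteMeasure Q] {f : Z → ℝ≥0∞} (hf : Measurable f)
    [IsFiniteMeasure (Q.withDensity f)] {g : Z → Y} (hg : Measurable g) {α c : ℝ} (hα : 1 < α)
    (h : ∫⁻ z, f z ^ α ∂Q ≤ ENNReal.ofReal (Real.exp ((α - 1) * c))) :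
    renyiDiv α ((Q.withDensity f).map g) (Q.map g) ≤ (c : EReal) := by
  have hα' : 0 < α - 1 := sub_pos.mpr hα
  rw [renyiDiv, if_pos ((withDensity_absolutelyContinuous Q f).map hg)]
  have h1 := ENNReal.log_le_log ((lintegral_rnDeriv_map_rpow_le hf hg hα).trans h)
  rw [ENNReal.log_ofReal, if_neg (not_le.mpr (Real.exp_pos _)), Real.log_exp] at h1
  refine (mul_le_mul_of_nonneg_left h1 (by exact_mod_cast (inv_pos.mpr hα').le)).trans ?_
  rw [← EReal.coe_mul, inv_mul_cancel_left₀ hα'.ne']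

/-! ### Densities, conditioning and marginals of product measures. -/

section Pi

variable {ι : Type*} [Fintype ι] {E : ι → Type*} [∀ i, MeasurableSpace (E i)]

theorem lintegral_pi_prod (μ : ∀ i, Measure (E i)) [∀ i, IsProbabilityMeasure (μ i)]
    {f : ∀ i, E i → ℝ≥0∞} (hf : ∀ i, Measurable (f i)) :
    ∫⁻ w, ∏ i, f i (w i) ∂(Measure.pi μ) = ∏ i, ∫⁻ z, f i z ∂(μ i) := by
  refine (lintegral_prod_eq_prod_lintegral_of_indepFun Finset.univ
    (fun i (w : ∀ i, E i) => f i (w i))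
    (iIndepFun_pi fun i => (hf i).aemeasurable)
    (fun i => (hf i).comp (measurable_pi_apply i))).trans ?_
  refine Finset.prod_congr rfl fun i _ => ?_
  exact (measurePreserving_eval μ i).lintegral_comp (hf i)

theorem pi_withDensity (μ : ∀ i, Measure (E i)) [∀ i, IsProbabilityMeasure (μ i)]
    {f : ∀ i, E i → ℝ≥0∞} (hf : ∀ i, Measurable (f i))
    [∀ i, SigmaFinite ((μ i).withDensity (f i))] :
    Measure.pi (fun i => (μ i).withDensity (f i)) =
      (Measure.pi μ).withDensity fun w => ∏ i, f i (w i) := by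
  refine Measure.pi_eq fun s hs => ?_
  rw [withDensity_apply _ (MeasurableSet.univ_pi hs), ← lintegral_indicator
    (MeasurableSet.univ_pi hs)]
  have : ∀ w, (Set.univ.pi s).indicator (fun w => ∏ i, f i (w i)) w =
      ∏ i, (s i).indicator (f i) (w i) := by
    intro w
    by_cases hw : w ∈ Set.univ.pi s
    · rw [Set.indicator_of_mem hw]
      exact Finset.prod_congr rfl fun i _ => (Set.indicator_of_mem (hw i trivial) _).symm
    · rw [Set.indicator_of_notMem hw]
      simp only [Set.mem_pi, Set.mem_univ, true_imp_iff, not_forall] at hw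
      obtain ⟨i, hi⟩ := hw
      exact (Finset.prod_eq_zero (Finset.mem_univ i) (Set.indicator_of_notMem hi _)).symm
  simp_rw [this]
  rw [lintegral_pi_prod μ fun i => (hf i).indicator (hs i)]
  exact Finset.prod_congr rfl fun i _ => by
    rw [lintegral_indicator (hs i), withDensity_apply _ (hs i)]

theorem cond_pi (μ : ∀ i, Measure (E i)) [∀ i, IsProbabilityMeasure (μ i)]
    {s : ∀ i, Set (E i)} (hs : ∀ i, MeasurableSet (s i)) :
    (Measure.pi μ)[|Set.univ.pi s] = Measure.pi fun i => (μ i)[|s i] := by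
  refine (Measure.pi_eq fun t ht => ?_).symm
  rw [cond_apply (MeasurableSet.univ_pi hs), ← Set.pi_inter_distrib, Measure.pi_pi,
    Measure.pi_pi, ENNReal.prod_inv_distrib, ← Finset.prod_mul_distrib]
  · exact Finset.prod_congr rfl fun i _ => (cond_apply (hs i) _ _).symm
  · exact fun i _ j _ _ => Or.inr (measure_ne_top _ _)

theorem map_pi_precomp {κ : Type*} [Fintype κ] {e : κ → ι} (he : Function.Injective e)
    (μ : ∀ i, Measure (E i)) [∀ i, IsProbabilityMeasure (μ i)] :
    (Measure.pi μ).map (fun w k => w (e k)) = Measure.pi fun k => μ (e k) := by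
  have h := (iIndepFun_pi (μ := μ) (X := fun i z => z) fun i => aemeasurable_id).precomp he
  rw [iIndepFun_iff_map_fun_eq_pi_map fun k =>
    (measurable_pi_apply (e k)).aemeasurable] at h
  refine h.trans ?_
  congr 1
  ext1 k
  exact (measurePreserving_eval μ (e k)).map_eq

end Pi

/-! ### Gaussians conditioned on an interval. -/

theorem gaussianPDFReal_le_of_abs_sub_le {v : ℝ≥0} {m x p y : ℝ} (h : |y - p| ≤ |x - m|) :
    gaussianPDFReal m v x ≤ gaussianPDFReal p v y := by
  unfold gaussianPDFReal
  have : (y - p) ^ 2 ≤ (x - m) ^ 2 := sq_le_sq.mpr h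
  gcongr

theorem gaussianReal_Icc_toReal {v : ℝ≥0} (hv : v ≠ 0) (m : ℝ) {a b : ℝ} (hab : a ≤ b) :
    gaussianReal m v (Set.Icc a b) = ENNReal.ofReal (∫ x in a..b, gaussianPDFReal m v x) := by
  rw [gaussianReal_apply_eq_integral _ hv, intervalIntegral.integral_of_le hab,
    integral_Icc_eq_integral_Ioc]

/-- Gaussian mass of an interval is invariant under reflecting the mean in its midpoint. -/
theorem gaussianReal_Icc_reflect {v : ℝ≥0} (m a b : ℝ) :
    gaussianReal (a + b - m) v (Set.Icc a b) = gaussianReal m v (Set.Icc a b) := by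
  rw [← gaussianReal_map_const_sub (a + b), Measure.map_apply (by fun_prop) measurableSet_Icc]
  congr 1
  ext z
  simp only [Set.mem_preimage, Set.mem_Icc]
  constructor <;> rintro ⟨h, h'⟩ <;> constructor <;> linarith

/-- Gaussian mass of an interval decreases as the mean moves away from its midpoint. -/
theorem gaussianReal_Icc_anti {v : ℝ≥0} (hv : v ≠ 0) {a b p m : ℝ} (hab : a ≤ b)
    (h : |2 * p - (a + b)| ≤ |2 * m - (a + b)|) :
    gaussianReal m v (Set.Icc a b) ≤ gaussianReal p v (Set.Icc a b) := by
  wlog hm : a + b ≤ 2 * m generalizing m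
  · rw [← gaussianReal_Icc_reflect m]
    refine this ?_ (by linarith)
    rwa [show 2 * (a + b - m) - (a + b) = -(2 * m - (a + b)) by ring, abs_neg]
  wlog hp : a + b ≤ 2 * p generalizing p
  · rw [← gaussianReal_Icc_reflect p]
    refine this ?_ (by linarith)
    rwa [show 2 * (a + b - p) - (a + b) = -(2 * p - (a + b)) by ring, abs_neg]
  rw [abs_of_nonneg (by linarith), abs_of_nonneg (by linarith)] at h
  have hpm : p ≤ m := by linarith
  rw [gaussianReal_Icc_toReal hv m hab, gaussianReal_Icc_toReal hv p hab]
  refine ENNReal.ofReal_le_ofReal ?_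
  set G := gaussianPDFReal 0 v with hG
  have hint : ∀ c d, IntervalIntegrable G volume c d := fun c d =>
    (integrable_gaussianPDFReal 0 v).intervalIntegrable
  have hshift : ∀ t, ∫ x in a..b, gaussianPDFReal t v x = ∫ x in (a - t)..(b - t), G x := by
    intro t
    rw [← intervalIntegral.integral_comp_sub_right]
    simp_rw [hG, gaussianPDFReal_sub, zero_add]
  have hmove : ∫ x in (b - m)..(b - p), G x =
      ∫ x in (a - m)..(a - p), G (x + (b - a)) := by
    rw [intervalIntegral.integral_comp_add_right]
    congr 1 <;> ring
  -- Moving the mean from `p` up to `m` gains the left strip and loses the right one. Translation by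
  -- `b - a` carries the left strip to the right one and brings its points no farther from 0, since
  -- `2 * p ≥ a + b`.
  have hmono : ∫ x in (a - m)..(a - p), G x ≤ ∫ x in (b - m)..(b - p), G x := by
    rw [hmove]
    refine intervalIntegral.integral_mono_on (by linarith) (hint _ _)
      ((integrable_gaussianPDFReal 0 v).comp_add_right (b - a)).intervalIntegrable ?_
    intro x hx
    refine gaussianPDFReal_le_of_abs_sub_le ?_
    rw [sub_zero, sub_zero, abs_of_nonpos (by linarith [hx.2] : x ≤ 0), abs_le]
    constructor <;> linarith [hx.2]
  rw [hshift, hshift]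
  have e1 := intervalIntegral.integral_add_adjacent_intervals (hint (a - m) (b - m))
    (hint (b - m) (b - p))
  have e2 := intervalIntegral.integral_add_adjacent_intervals (hint (a - m) (a - p))
    (hint (a - p) (b - p))
  linarith

/-- The means are mirror images in the midpoint of the interval, so both Gaussians give it the same
mass and only the ratio of the unconditioned densities remains. -/
theorem cond_gaussianReal_withDensity {v : ℝ≥0} (hv : v ≠ 0) {p q a b : ℝ} (hab : a + b = p + q) :
    (gaussianReal p v)[|Set.Icc a b] = ((gaussianReal q v)[|Set.Icc a b]).withDensity
      fun z => ENNReal.ofReal (Real.exp (((z - q) ^ 2 - (z - p) ^ 2) / (2 * v))) := by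
  have hpq : gaussianReal p v (Set.Icc a b) = gaussianReal q v (Set.Icc a b) := by
    rw [← gaussianReal_Icc_reflect q, hab, add_sub_cancel_right]
  rw [ProbabilityTheory.cond, ProbabilityTheory.cond, hpq, withDensity_smul_measure,
    ← restrict_withDensity measurableSet_Icc, gaussianReal_of_var_ne_zero _ hv,
    gaussianReal_of_var_ne_zero _ hv, ← withDensity_mul _ (measurable_gaussianPDF _ _)
      (by fun_prop)]
  congr 3
  ext z
  rw [Pi.mul_apply, gaussianPDF, gaussianPDF, ← ENNReal.ofReal_mul (gaussianPDFReal_nonneg _ _ _),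
    gaussianPDFReal, gaussianPDFReal, mul_assoc (_)⁻¹, ← Real.exp_add]
  congr 3
  field_simp
  ring

/-- The Rényi moment of two Gaussians of equal variance conditioned on an interval that is
symmetric about the midpoint of the means. -/
theorem lintegral_cond_gaussianReal_rpow_le {v : ℝ≥0} (hv : v ≠ 0) {p q a b α : ℝ}
    (hab : a + b = p + q) (hle : a ≤ b) (hα : 1 < α) :
    ∫⁻ z, ENNReal.ofReal (Real.exp (((z - q) ^ 2 - (z - p) ^ 2) / (2 * v))) ^ α
      ∂((gaussianReal q v)[|Set.Icc a b]) ≤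
      ENNReal.ofReal (Real.exp ((α - 1) * (α * ((p - q) ^ 2 / (2 * v))))) := by
  set m := α * p + (1 - α) * q with hm
  have hv' : (v : ℝ) ≠ 0 := by exact_mod_cast hv
  -- Completing the square: the tilted density is a multiple of a Gaussian density with the
  -- extrapolated mean `m`.
  have hdens : ∀ z, gaussianPDF q v z *
      ENNReal.ofReal (Real.exp (((z - q) ^ 2 - (z - p) ^ 2) / (2 * v))) ^ α =
      ENNReal.ofReal (Real.exp ((α - 1) * (α * ((p - q) ^ 2 / (2 * v))))) *
        gaussianPDF m v z := by
    intro z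
    rw [ENNReal.ofReal_rpow_of_pos (Real.exp_pos _), gaussianPDF, gaussianPDF,
      ← ENNReal.ofReal_mul (gaussianPDFReal_nonneg _ _ _), ← ENNReal.ofReal_mul (Real.exp_pos _).le,
      gaussianPDFReal, gaussianPDFReal, mul_assoc, ← Real.exp_mul, ← Real.exp_add, mul_left_comm,
      ← Real.exp_add]
    congr 3
    field_simp
    rw [hm]
    ring
  -- Relative to the midpoint, `m` is `2 * α - 1 > 1` times as far away as `q`.
  have hle' : gaussianReal m v (Set.Icc a b) ≤ gaussianReal q v (Set.Icc a b) := by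
    refine gaussianReal_Icc_anti hv hle ?_
    rw [hab, hm, show 2 * q - (p + q) = -(p - q) by ring, abs_neg,
      show 2 * (α * p + (1 - α) * q) - (p + q) = (2 * α - 1) * (p - q) by ring, abs_mul,
      abs_of_pos (by linarith : 0 < 2 * α - 1)]
    nlinarith [abs_nonneg (p - q)]
  rw [ProbabilityTheory.cond, lintegral_smul_measure, gaussianReal_of_var_ne_zero _ hv,
    restrict_withDensity measurableSet_Icc,
    lintegral_withDensity_eq_lintegral_mul _ (measurable_gaussianPDF _ _) (by fun_prop)]
  simp only [Pi.mul_apply, hdens]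
  rw [lintegral_const_mul _ (measurable_gaussianPDF _ _), ← gaussianReal_apply _ hv,
    ← gaussianReal_of_var_ne_zero _ hv, smul_eq_mul, mul_left_comm]
  refine mul_le_of_le_one_right' ?_
  rw [mul_comm, ← div_eq_mul_inv]
  exact ENNReal.div_le_of_le_mul (by simpa using hle')

/-! ### The truncated normal as a restricted Gaussian. -/

theorem stdNormalCDF_neg (x : ℝ) : stdNormalCDF (-x) = 1 - stdNormalCDF x := by
  have : NullSingletonClass (gaussianReal 0 1) := nullSingletonClass_gaussianReal (by simp)
  rw [stdNormalCDF, stdNormalCDF, cdf_eq_real, cdf_eq_real]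
  have h : (gaussianReal 0 1).real (Set.Iic (-x)) = (gaussianReal 0 1).real (Set.Iic x)ᶜ := by
    have h0 := gaussianReal_map_neg (μ := 0) (v := 1)
    rw [neg_zero] at h0
    conv_lhs => rw [← h0]
    rw [map_measureReal_apply (by fun_prop) measurableSet_Iic, Set.compl_Iic]
    have : (fun z : ℝ => -z) ⁻¹' Set.Iic (-x) = Set.Ici x := by ext; simp
    rw [this]
    exact measureReal_congr Ioi_ae_eq_Ici.symm
  rw [h, probReal_compl_eq_one_sub measurableSet_Iic]

theorem gaussianReal_Icc_eq_stdNormalCDF {s : ℝ} (hs : 0 < s) (m : ℝ) {a b : ℝ} (hab : a ≤ b) :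
    gaussianReal m (.mk (s ^ 2) (sq_nonneg _)) (Set.Icc a b) =
      ENNReal.ofReal (stdNormalCDF ((b - m) / s) - stdNormalCDF ((a - m) / s)) := by
  have h1 : gaussianReal m (.mk (s ^ 2) (sq_nonneg _)) =
      (gaussianReal 0 1).map (fun z => s * z + m) := by
    rw [show (fun z : ℝ => s * z + m) = (fun z => z + m) ∘ (fun z => s * z) from rfl,
      ← Measure.map_map (by fun_prop) (by fun_prop), gaussianReal_map_const_mul (μ := 0) (v := 1) s,
      gaussianReal_map_add_const]
    simp
  rw [h1, Measure.map_apply (by fun_prop) measurableSet_Icc, ← stdNormalCDF_sub (by gcongr)]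
  congr 1
  ext z
  simp only [Set.mem_preimage, Set.mem_Icc, div_le_iff₀ hs, le_div_iff₀ hs]
  constructor <;> rintro ⟨h, h'⟩ <;> constructor <;> linarith

theorem truncNormal_eq_smul_restrict {T s : ℝ} (hT : 0 < T) (hs : 0 < s) (m : ℝ) :
    truncNormal T m s = ENNReal.ofReal (stdNormalCDF (T / s) - stdNormalCDF (-T / s))⁻¹ •
      (gaussianReal m (.mk (s ^ 2) (sq_nonneg _))).restrict (Set.Icc (m - T) (m + T)) := by
  have hlt : -T / s < T / s := by
    rw [div_lt_div_iff_of_pos_right hs]; linarith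
  set c := stdNormalCDF (T / s) - stdNormalCDF (-T / s) with hc
  have hcpos : 0 < c := sub_pos.mpr (stdNormalCDF_lt hlt)
  have hs2 : (NNReal.mk (s ^ 2) (sq_nonneg _)) ≠ 0 := by
    intro h
    have := congrArg NNReal.toReal h
    simp at this
    exact hs.ne' this
  rw [gaussianReal_of_var_ne_zero _ hs2, restrict_withDensity measurableSet_Icc,
    ← withDensity_indicator measurableSet_Icc,
    ← withDensity_smul _ ((measurable_gaussianPDF _ _).indicator measurableSet_Icc), truncNormal]
  congr 1
  ext1 z
  rw [Pi.smul_apply, smul_eq_mul]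
  unfold truncNormalPDF
  by_cases hz : m - T ≤ z ∧ z ≤ m + T
  · rw [if_pos hz, Set.indicator_of_mem (show z ∈ Set.Icc _ _ from hz), gaussianPDF,
      ← ENNReal.ofReal_mul (by positivity)]
    congr 1
    have hs0 : s ≠ 0 := hs.ne'
    simp only [stdNormalPDF, gaussianPDFReal]
    have hsq : Real.sqrt (2 * Real.pi * s ^ 2) = Real.sqrt (2 * Real.pi) * s := by
      rw [Real.sqrt_mul (by positivity), Real.sqrt_sq hs.le]
    simp only [NNReal.coe_mk, NNReal.coe_one, hsq, mul_one, ← hc]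
    have he : -((z - m) / s - 0) ^ 2 / 2 = -(z - m) ^ 2 / (2 * s ^ 2) := by
      field_simp
      ring
    rw [he]
    field_simp
  · rw [if_neg hz, Set.indicator_of_notMem (show z ∉ Set.Icc _ _ from hz)]
    simp

theorem truncNormal_Icc {T s : ℝ} (hT : 0 < T) (hs : 0 < s) {m a b : ℝ} (hab : a ≤ b)
    (ha : m - T ≤ a) (hb : b ≤ m + T) :
    truncNormal T m s (Set.Icc a b) = ENNReal.ofReal
      ((stdNormalCDF ((b - m) / s) - stdNormalCDF ((a - m) / s)) /
        (stdNormalCDF (T / s) - stdNormalCDF (-T / s))) := by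
  have hlt : -T / s < T / s := by
    rw [div_lt_div_iff_of_pos_right hs]; linarith
  have hcpos := sub_pos.mpr (stdNormalCDF_lt hlt)
  rw [truncNormal_eq_smul_restrict hT hs, Measure.smul_apply,
    Measure.restrict_apply measurableSet_Icc, Set.inter_eq_left.mpr (Set.Icc_subset_Icc ha hb),
    gaussianReal_Icc_eq_stdNormalCDF hs m hab, smul_eq_mul, ← ENNReal.ofReal_mul (by positivity)]
  congr 1
  exact (div_eq_inv_mul _ _).symm

/-- Inside the support, truncation only rescales the Gaussian, and conditioning cancels the scale.
-/
theorem cond_truncNormal {T s : ℝ} (hT : 0 < T) (hs : 0 < s) {m a b : ℝ}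
    (ha : m - T ≤ a) (hb : b ≤ m + T) :
    (truncNormal T m s)[|Set.Icc a b] =
      (gaussianReal m (.mk (s ^ 2) (sq_nonneg _)))[|Set.Icc a b] := by
  have hlt : -T / s < T / s := by
    rw [div_lt_div_iff_of_pos_right hs]; linarith
  have hcpos := sub_pos.mpr (stdNormalCDF_lt hlt)
  rw [truncNormal_eq_smul_restrict hT hs]
  set k := ENNReal.ofReal (stdNormalCDF (T / s) - stdNormalCDF (-T / s))⁻¹
  have hk0 : k ≠ 0 := by simpa [k] using hcpos
  have hk : k ≠ ∞ := ENNReal.ofReal_ne_top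
  ext t ht
  rw [cond_apply measurableSet_Icc, cond_apply measurableSet_Icc, Measure.smul_apply,
    Measure.smul_apply, Measure.restrict_apply measurableSet_Icc,
    Measure.restrict_apply (measurableSet_Icc.inter ht),
    Set.inter_eq_left.mpr (Set.Icc_subset_Icc ha hb),
    Set.inter_eq_left.mpr (Set.inter_subset_left.trans (Set.Icc_subset_Icc ha hb)), smul_eq_mul,
    smul_eq_mul, ENNReal.mul_inv (Or.inl hk0) (Or.inl hk), mul_mul_mul_comm,
    ENNReal.inv_mul_cancel hk0 hk, one_mul]

/-- A truncated Gaussian falls within `T` of a mean at distance at most `τ` with at least the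
probability of falling within `T` of a mean at distance `τ`. -/
theorem le_truncNormal_Icc {T s τ : ℝ} (hT : 0 < T) (hs : 0 < s) (hτT : τ ≤ 2 * T) {m n : ℝ}
    (hmn : |m - n| ≤ τ) :
    ENNReal.ofReal ((stdNormalCDF (T / s) - stdNormalCDF ((τ - T) / s)) /
        (stdNormalCDF (T / s) - stdNormalCDF (-T / s))) ≤
      truncNormal T m s (Set.Icc (max m n - T) (min m n + T)) := by
  have hlt : -T / s < T / s := by
    rw [div_lt_div_iff_of_pos_right hs]; linarith
  have hcpos := sub_pos.mpr (stdNormalCDF_lt hlt)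
  have hmono : Monotone stdNormalCDF := monotone_cdf _
  obtain ⟨h1, h2⟩ := abs_le.mp hmn
  rcases le_total m n with h | h
  · rw [max_eq_right h, min_eq_left h, truncNormal_Icc hT hs (by linarith) (by linarith) le_rfl]
    refine ENNReal.ofReal_le_ofReal (div_le_div_of_nonneg_right ?_ hcpos.le)
    have e : stdNormalCDF ((n - T - m) / s) ≤ stdNormalCDF ((τ - T) / s) :=
      hmono (div_le_div_of_nonneg_right (by linarith) hs.le)
    rw [add_sub_cancel_left]
    linarith
  -- Here the upper end of the support is cut off instead of the lower; the symmetry of `Φ` converts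
  -- one case into the other.
  · rw [max_eq_left h, min_eq_right h, truncNormal_Icc hT hs (by linarith) le_rfl (by linarith)]
    refine ENNReal.ofReal_le_ofReal (div_le_div_of_nonneg_right ?_ hcpos.le)
    have e1 := stdNormalCDF_neg ((T - τ) / s)
    have e2 := stdNormalCDF_neg (T / s)
    have e3 : stdNormalCDF ((T - τ) / s) ≤ stdNormalCDF ((n + T - m) / s) :=
      hmono (div_le_div_of_nonneg_right (by linarith) hs.le)
    rw [← neg_div, neg_sub] at e1
    rw [← neg_div] at e2
    rw [show m - T - m = -T by ring]
    linarith

theorem truncNormal_Icc_ne_zero {T s τ : ℝ} (hT : 0 < T) (hs : 0 < s) (hτT : τ < 2 * T) {m n : ℝ}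
    (hmn : |m - n| ≤ τ) :
    truncNormal T m s (Set.Icc (max m n - T) (min m n + T)) ≠ 0 := by
  have hlt : -T / s < T / s := by
    rw [div_lt_div_iff_of_pos_right hs]; linarith
  have hlt' : (τ - T) / s < T / s := by
    rw [div_lt_div_iff_of_pos_right hs]; linarith
  refine (lt_of_lt_of_le ?_ (le_truncNormal_Icc hT hs hτT.le hmn)).ne'
  exact ENNReal.ofReal_pos.mpr
    (div_pos (sub_pos.mpr (stdNormalCDF_lt hlt')) (sub_pos.mpr (stdNormalCDF_lt hlt)))

/-! ### Ranks, elements and partner counts. -/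

namespace TruncGauss

variable {U : Type*}

theorem nodup_sortedElements (h : U →₀ ℕ) : (sortedElements h).Nodup :=
  (List.mergeSort_perm _ _).nodup_iff.mpr h.support.nodup_toList

theorem mem_sortedElements {h : U →₀ ℕ} {a : U} : a ∈ sortedElements h ↔ h a ≠ 0 := by
  rw [sortedElements, (List.mergeSort_perm _ _).mem_iff, Finset.mem_toList, Finsupp.mem_support_iff]

theorem length_sortedElements (h : U →₀ ℕ) : (sortedElements h).length = h.support.card := by
  rw [sortedElements, (List.mergeSort_perm _ _).length_eq, Finset.length_toList]

theorem ne_zero_of_getElem?_sortedElements {h : U →₀ ℕ} {i : ℕ} {a : U}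
    (hi : (sortedElements h)[i]? = some a) : h a ≠ 0 :=
  mem_sortedElements.mp (List.mem_of_getElem? hi)

theorem getElem?_sortedElements_inj {h : U →₀ ℕ} {i j : ℕ} {a : U}
    (hi : (sortedElements h)[i]? = some a) (hj : (sortedElements h)[j]? = some a) : i = j := by
  obtain ⟨hi', -⟩ := List.getElem?_eq_some_iff.mp hi
  exact (List.getElem?_inj hi' (nodup_sortedElements h)).mp (hi.trans hj.symm)

theorem exists_getElem?_sortedElements {h : U →₀ ℕ} {dbar : ℕ} (hd : h.support.card ≤ dbar)
    {a : U} (ha : h a ≠ 0) : ∃ i : Fin dbar, (sortedElements h)[(i : ℕ)]? = some a := by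
  obtain ⟨i, hi⟩ := List.mem_iff_getElem?.mp (mem_sortedElements.mpr ha)
  obtain ⟨hi', -⟩ := List.getElem?_eq_some_iff.mp hi
  rw [length_sortedElements] at hi'
  exact ⟨⟨i, hi'.trans_le hd⟩, hi⟩

theorem sortedCount_of_some {h : U →₀ ℕ} {i : ℕ} {a : U}
    (hi : (sortedElements h)[i]? = some a) : sortedCount h i = h a := by
  rw [sortedCount, hi]

/-- The count in `k` of the `i`-th element of `h`, or its count in `h` if `k` does not contain
the element. -/
def partnerCount (h k : U →₀ ℕ) (i : ℕ) : ℕ :=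
  match (sortedElements h)[i]? with
  | some a => if k a = 0 then h a else k a
  | none => 0

theorem partnerCount_of_some {h k : U →₀ ℕ} {i : ℕ} {a : U}
    (hi : (sortedElements h)[i]? = some a) (hk : k a ≠ 0) : partnerCount h k i = k a := by
  rw [partnerCount, hi]
  exact if_neg hk

theorem exists_of_sortedCount_ne_partnerCount {h k : U →₀ ℕ} {i : ℕ}
    (hne : sortedCount h i ≠ partnerCount h k i) :
    ∃ a, (sortedElements h)[i]? = some a ∧ sortedCount h i = h a ∧ partnerCount h k i = k a := by
  unfold sortedCount partnerCount at *
  split at hne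
  · rename_i a ha
    refine ⟨a, ha, ?_⟩
    simp only at hne ⊢
    split_ifs at hne ⊢ with hk
    · exact absurd rfl hne
    · exact ⟨trivial, rfl⟩
  · simp at hne

theorem abs_sortedCount_sub_partnerCount_le {h k : U →₀ ℕ} {τ : ℝ} (hτ : 0 ≤ τ)
    (hhk : ∀ a, |(h a : ℝ) - k a| ≤ τ) (i : ℕ) :
    |(sortedCount h i : ℝ) - partnerCount h k i| ≤ τ := by
  by_cases hne : sortedCount h i = partnerCount h k i
  · simpa [hne] using hτ
  · obtain ⟨a, -, h1, h2⟩ := exists_of_sortedCount_ne_partnerCount hne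
    rw [h1, h2]
    exact hhk a

theorem finite_setOf_ne (h k : U →₀ ℕ) : {a | h a ≠ k a}.Finite := by
  classical
  refine (h.support ∪ k.support).finite_toSet.subset fun a ha => ?_
  simp only [Finset.coe_union, Set.mem_union, Finset.mem_coe, Finsupp.mem_support_iff]
  by_contra! hc
  exact ha (hc.1.trans hc.2.symm)

/-- A rank where the two counts differ carries an element whose counts in `h` and `k` differ, and
distinct ranks carry distinct elements. The lookup is `Option`-valued, hence the comparison inside
`Option U`. -/
theorem card_sortedCount_ne_partnerCount_le (dbar : ℕ) (h k : U →₀ ℕ) :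
    (Finset.univ.filter fun i : Fin dbar => sortedCount h i ≠ partnerCount h k i).card ≤
      {a | h a ≠ k a}.ncard := by
  classical
  have hfin := finite_setOf_ne h k
  rw [Set.ncard_eq_toFinset_card _ hfin, ← Finset.card_map (s := hfin.toFinset)
    Function.Embedding.some]
  refine Finset.card_le_card_of_injOn (fun i : Fin dbar => (sortedElements h)[(i : ℕ)]?) ?_ ?_
  · intro i hi
    obtain ⟨a, ha, h1, h2⟩ := exists_of_sortedCount_ne_partnerCount (Finset.mem_filter.mp hi).2
    refine Finset.mem_map.mpr ⟨a, hfin.mem_toFinset.mpr ?_, ha.symm⟩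
    have hne := (Finset.mem_filter.mp hi).2
    rwa [h1, h2] at hne
  · intro i hi j hj hij
    obtain ⟨a, ha, -⟩ := exists_of_sortedCount_ne_partnerCount (Finset.mem_filter.mp hi).2
    exact Fin.ext (getElem?_sortedElements_inj ha (hij.symm.trans ha))

/-! ### The conditioning event: its probability and the conditional output law. -/

/-- The event that every noisy count is within `T` both of the count in `h` and of the count
in `k`. -/
def commonEvent (dbar : ℕ) (T : ℝ) (h k : U →₀ ℕ) : Set (Fin dbar → ℝ) :=
  Set.univ.pi fun i : Fin dbar => Set.Icc
    (max (sortedCount h i : ℝ) (partnerCount h k i) - T)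
    (min (sortedCount h i : ℝ) (partnerCount h k i) + T)

theorem measurableSet_commonEvent (dbar : ℕ) (T : ℝ) (h k : U →₀ ℕ) :
    MeasurableSet (commonEvent dbar T h k) :=
  MeasurableSet.univ_pi fun _ => measurableSet_Icc

/-- The pairs of an element of `K` and its noisy count, for the noisy counts above `θ`. -/
def releaseOn (K : Finset U) (θ : ℝ) (w : K → ℝ) : Release U :=
  open Classical in
  ⟨((Finset.univ : Finset K).filter fun a => θ < w a).image fun a : K => ((a : U), w a)⟩

theorem mem_releaseOn {K : Finset U} {θ : ℝ} {w : K → ℝ} {a : U} {r : ℝ} :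
    (a, r) ∈ (releaseOn K θ w).entries ↔ ∃ ha : a ∈ K, w ⟨a, ha⟩ = r ∧ θ < r := by
  simp only [releaseOn, Finset.mem_image, Finset.mem_filter, Finset.mem_univ, true_and,
    Prod.mk.injEq]
  constructor
  · rintro ⟨⟨b, hb⟩, hw, rfl, rfl⟩
    exact ⟨hb, rfl, hw⟩
  · rintro ⟨ha, rfl, hr⟩
    exact ⟨⟨a, ha⟩, hr, rfl, rfl⟩

theorem measurable_releaseOn (K : Finset U) (θ : ℝ) : Measurable (releaseOn K θ) := by
  refine measurable_generateFrom ?_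
  rintro A ⟨a, B, hB, rfl⟩
  have : releaseOn K θ ⁻¹' {S | ∃ r ∈ B, (a, r) ∈ S.entries} =
      ⋃ ha : a ∈ K, (fun w : K → ℝ => w ⟨a, ha⟩) ⁻¹' (B ∩ Set.Ioi θ) := by
    ext w
    simp only [Set.mem_preimage, Set.mem_ofPred_eq, mem_releaseOn, Set.mem_iUnion, Set.mem_inter_iff,
      Set.mem_Ioi]
    constructor
    · rintro ⟨r, hr, ha, rfl, hθ⟩
      exact ⟨ha, hr, hθ⟩
    · rintro ⟨ha, hr, hθ⟩
      exact ⟨_, hr, ha, rfl, hθ⟩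
  rw [this]
  exact MeasurableSet.iUnion fun ha => measurable_pi_apply _ (hB.inter measurableSet_Ioi)

theorem mem_release {dbar : ℕ} {τ T : ℝ} {h : U →₀ ℕ} {v : Fin dbar → ℝ} {a : U} {r : ℝ} :
    (a, r) ∈ (release dbar τ T h v).entries ↔
      ∃ i : Fin dbar, (sortedElements h)[(i : ℕ)]? = some a ∧ v i = r ∧ τ + T < r := by
  simp only [release, Finset.mem_biUnion, Finset.mem_univ, true_and]
  refine exists_congr fun i => ?_
  split
  · rename_i b hb
    split_ifs with hv
    · simp only [Finset.mem_singleton, Prod.mk.injEq, hb, Option.some.injEq]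
      constructor
      · rintro ⟨rfl, rfl⟩
        exact ⟨rfl, rfl, hv⟩
      · rintro ⟨rfl, rfl, -⟩
        exact ⟨rfl, rfl⟩
    · simp only [Finset.notMem_empty, false_iff]
      rintro ⟨-, rfl, h'⟩
      exact hv h'
  · rename_i hb
    simp [hb]

/-- On the event, elements absent from `k` stay below the threshold, so indexing by rank can be
replaced by indexing by common element, which is the same for both runs. -/
theorem release_eq_releaseOn {dbar : ℕ} {τ T : ℝ} {h k : U →₀ ℕ} {K : Finset U}
    (hK : ∀ a, a ∈ K ↔ h a ≠ 0 ∧ k a ≠ 0) (hhk : ∀ a, |(h a : ℝ) - k a| ≤ τ)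
    {e : K → Fin dbar} (he : ∀ a : K, (sortedElements h)[(e a : ℕ)]? = some (a : U))
    {v : Fin dbar → ℝ} (hv : v ∈ commonEvent dbar T h k) :
    release dbar τ T h v = releaseOn K (τ + T) fun a => v (e a) := by
  ext ⟨a, r⟩
  rw [mem_release, mem_releaseOn]
  constructor
  · rintro ⟨i, hi, rfl, hr⟩
    have ha : h a ≠ 0 := ne_zero_of_getElem?_sortedElements hi
    -- Otherwise `h a ≤ τ`, so the noisy count is at most `τ + T` and is not released.
    have hk : k a ≠ 0 := by
      intro hk
      have h1 := (hv i trivial).2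
      have h2 := hhk a
      rw [hk, Nat.cast_zero, sub_zero, ← sortedCount_of_some hi] at h2
      have h3 := min_le_left (sortedCount h i : ℝ) (partnerCount h k i)
      linarith [le_abs_self (sortedCount h i : ℝ)]
    have haK : a ∈ K := (hK a).mpr ⟨ha, hk⟩
    refine ⟨haK, ?_, hr⟩
    rw [show e ⟨a, haK⟩ = i from Fin.ext (getElem?_sortedElements_inj (he ⟨a, haK⟩) hi)]
  · rintro ⟨ha, rfl, hr⟩
    exact ⟨e ⟨a, ha⟩, he ⟨a, ha⟩, rfl, hr⟩

/-- Conditioned on `commonEvent`, the output is a function of independent Gaussians conditioned on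
intervals, one for each common element of the two histograms. -/
theorem condLaw_mechanism_commonEvent {X : Type*} (hist : X → U →₀ ℕ) {dbar : ℕ} {τ σ T : ℝ}
    (hτ : 0 < τ) (hσ : 0 < σ) (hT : 0 < T) {x x' : X} {K : Finset U}
    (hK : ∀ a, a ∈ K ↔ hist x a ≠ 0 ∧ hist x' a ≠ 0)
    (hhk : ∀ a, |(hist x a : ℝ) - hist x' a| ≤ τ) (hd : (hist x).support.card ≤ dbar)
    (hτT : τ < 2 * T) :
    ((mechanism U dbar hτ hσ hT).comp hist).condLaw x
        (commonEvent dbar T (hist x) (hist x')) =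
      (Measure.pi fun a : K => (gaussianReal (hist x a) (.mk ((τ * σ) ^ 2) (sq_nonneg _)))[|Set.Icc
        (max (hist x a : ℝ) (hist x' a) - T) (min (hist x a : ℝ) (hist x' a) + T)]).map
        (releaseOn K (τ + T)) := by
  set h := hist x
  set k := hist x'
  have hs : 0 < τ * σ := mul_pos hτ hσ
  choose e he using fun a : K => exists_getElem?_sortedElements hd ((hK a).mp a.2).1
  have heinj : Function.Injective e := fun a b hab => Subtype.ext <| by
    have := he a
    rw [hab, he b] at this
    exact (Option.some.inj this).symm
  set J : Fin dbar → Set ℝ := fun i => Set.Icc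
    (max (sortedCount h i : ℝ) (partnerCount h k i) - T)
    (min (sortedCount h i : ℝ) (partnerCount h k i) + T) with hJ
  have hJm : ∀ i, MeasurableSet (J i) := fun i => measurableSet_Icc
  have hprob := fun i : Fin dbar => isProbabilityMeasure_truncNormal hT hs (sortedCount h i)
  have hcond : ∀ i : Fin dbar, IsProbabilityMeasure ((truncNormal T (sortedCount h i) (τ * σ))[|J i]) :=
    fun i => cond_isProbabilityMeasure (truncNormal_Icc_ne_zero hT hs hτT
      (abs_sortedCount_sub_partnerCount_le hτ.le hhk i))
  have hcongr : release dbar τ T h =ᵐ[(Measure.pi fun i : Fin dbar =>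
      truncNormal T (sortedCount h i) (τ * σ))[|commonEvent dbar T h k]]
      releaseOn K (τ + T) ∘ fun v a => v (e a) := by
    filter_upwards [ae_cond_mem (measurableSet_commonEvent dbar T h k)] with v hv
    exact release_eq_releaseOn hK hhk he hv
  change Measure.map (release dbar τ T h) ((Measure.pi fun i : Fin dbar =>
      truncNormal T (sortedCount h i) (τ * σ))[|commonEvent dbar T h k]) = _
  rw [Measure.map_congr hcongr, ← Measure.map_map (measurable_releaseOn _ _) (by fun_prop),
    commonEvent, cond_pi _ hJm, map_pi_precomp heinj]
  congr 2
  ext1 a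
  simp only [hJ]
  rw [cond_truncNormal hT hs (by gcongr; exact le_max_left _ _) (by gcongr; exact min_le_left _ _),
    sortedCount_of_some (he a), partnerCount_of_some (he a) ((hK a).mp a.2).2]

/-- By independence the probability is a product over ranks. A rank whose count equals its partner
count contributes 1, the interval being the whole support; each of the at most `Δ` others
contributes at least `q`. -/
theorem le_prob_commonEvent {dbar : ℕ} {τ σ T : ℝ}
    (hτ : 0 < τ) (hσ : 0 < σ) (hT : 0 < T) {h k : U →₀ ℕ} {Δ : ℕ}
    (hhk : ∀ a, |(h a : ℝ) - k a| ≤ τ) (hΔ : {a | h a ≠ k a}.ncard ≤ Δ) {q : ℝ} (hτT : τ ≤ 2 * T)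
    (hq : q = (stdNormalCDF (T / (τ * σ)) - stdNormalCDF ((τ - T) / (τ * σ))) /
      (stdNormalCDF (T / (τ * σ)) - stdNormalCDF (-T / (τ * σ)))) (hq1 : q ≤ 1) :
    ENNReal.ofReal q ^ Δ ≤ (mechanism U dbar hτ hσ hT).prob h (commonEvent dbar T h k) := by
  have hs : 0 < τ * σ := mul_pos hτ hσ
  have := fun i : Fin dbar => isProbabilityMeasure_truncNormal hT hs (sortedCount h i)
  simp only [mechanism, commonEvent, Measure.pi_pi]
  have hq1' : ENNReal.ofReal q ≤ 1 := by simpa using hq1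
  refine (pow_le_pow_right_of_le_one' hq1'
    ((card_sortedCount_ne_partnerCount_le dbar h k).trans hΔ)).trans ?_
  rw [← Finset.prod_const, Finset.prod_filter]
  refine Finset.prod_le_prod' fun i _ => ?_
  split_ifs with hi
  · rw [hq]
    exact le_truncNormal_Icc hT hs hτT (abs_sortedCount_sub_partnerCount_le hτ.le hhk i)
  · have hlt : -T / (τ * σ) < T / (τ * σ) := by
      rw [div_lt_div_iff_of_pos_right hs]; linarith
    rw [← not_not.mp hi, max_self, min_self, truncNormal_Icc hT hs (by linarith) le_rfl le_rfl,
      add_sub_cancel_left, show (sortedCount h i : ℝ) - T - sortedCount h i = -T by ring,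
      div_self (sub_pos.mpr (stdNormalCDF_lt hlt)).ne', ENNReal.ofReal_one]

end TruncGauss

/-! ### The divergence bound. -/

/-- Rényi divergence between functions of independent Gaussians of equal variance conditioned on
intervals that are symmetric about the midpoints of the means. -/
theorem renyiDiv_map_pi_cond_gaussianReal_le {ι Y : Type*} [Fintype ι] [MeasurableSpace Y]
    {v : ℝ≥0} (hv : v ≠ 0) {p q a b : ι → ℝ} (hab : ∀ i, a i + b i = p i + q i)
    (hle : ∀ i, a i < b i) {g : (ι → ℝ) → Y} (hg : Measurable g) {α : ℝ} (hα : 1 < α) :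
    renyiDiv α ((Measure.pi fun i => (gaussianReal (p i) v)[|Set.Icc (a i) (b i)]).map g)
      ((Measure.pi fun i => (gaussianReal (q i) v)[|Set.Icc (a i) (b i)]).map g) ≤
      ((α * ∑ i, (p i - q i) ^ 2 / (2 * v) : ℝ) : EReal) := by
  have hne : ∀ (m : ℝ) i, gaussianReal m v (Set.Icc (a i) (b i)) ≠ 0 := fun m i h0 => by
    have := gaussianReal_absolutelyContinuous' m hv h0
    rw [Real.volume_Icc] at this
    exact absurd (hle i) (by simpa using this)
  have hP : ∀ (m : ι → ℝ) i, IsProbabilityMeasure ((gaussianReal (m i) v)[|Set.Icc (a i) (b i)]) :=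
    fun m i => cond_isProbabilityMeasure (hne _ i)
  have hPp := hP p
  have hPq := hP q
  have hdens := fun i => cond_gaussianReal_withDensity hv (hab i)
  simp_rw [hdens] at hPp ⊢
  have hfin : IsFiniteMeasure (Measure.pi fun i =>
    ((gaussianReal (q i) v)[|Set.Icc (a i) (b i)]).withDensity
      fun z => ENNReal.ofReal (Real.exp (((z - q i) ^ 2 - (z - p i) ^ 2) / (2 * v)))) := inferInstance
  have hf : ∀ i, Measurable fun z : ℝ =>
      ENNReal.ofReal (Real.exp (((z - q i) ^ 2 - (z - p i) ^ 2) / (2 * v))) := fun i => by fun_prop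
  rw [pi_withDensity _ hf] at hfin ⊢
  refine renyiDiv_map_withDensity_le (by fun_prop) hg hα ?_
  simp_rw [← ENNReal.prod_rpow_of_nonneg (zero_le_one.trans hα.le)]
  rw [lintegral_pi_prod (fun i => (gaussianReal (q i) v)[|Set.Icc (a i) (b i)])
    fun i => (hf i).pow_const α]
  rw [Finset.mul_sum, Finset.mul_sum, Real.exp_sum,
    ENNReal.ofReal_prod_of_nonneg fun _ _ => (Real.exp_pos _).le]
  exact Finset.prod_le_prod' fun i _ =>
    lintegral_cond_gaussianReal_rpow_le hv (hab i) (hle i).le hα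

namespace TruncGauss

variable {U : Type*}

theorem sum_sq_sub_le {h k : U →₀ ℕ} {τ : ℝ} {Δ : ℕ} (hhk : ∀ a, |(h a : ℝ) - k a| ≤ τ)
    (hΔ : {a | h a ≠ k a}.ncard ≤ Δ) (K : Finset U) :
    ∑ a : K, ((h a : ℝ) - k a) ^ 2 ≤ Δ * τ ^ 2 := by
  classical
  have hfin := finite_setOf_ne h k
  have hcard : (K.filter fun a => h a ≠ k a).card ≤ Δ := by
    refine le_trans ?_ hΔ
    rw [← Set.ncard_coe_finset]
    exact Set.ncard_le_ncard (fun a ha => (Finset.mem_filter.mp ha).2) hfin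
  rw [Finset.sum_coe_sort K fun a => ((h a : ℝ) - k a) ^ 2,
    ← Finset.sum_filter_of_ne (p := fun a => h a ≠ k a) fun a _ hne heq => hne (by simp [heq])]
  refine (Finset.sum_le_card_nsmul _ _ (τ ^ 2) fun a _ => ?_).trans ?_
  · exact sq_le_sq' (abs_le.mp (hhk a)).1 (abs_le.mp (hhk a)).2
  · rw [nsmul_eq_mul]
    gcongr

theorem renyiDiv_condLaw_mechanism_le {X : Type*} (hist : X → U →₀ ℕ) {dbar Δ : ℕ} {τ σ T : ℝ}
    (hτ : 0 < τ) (hσ : 0 < σ) (hT : 0 < T) {x x' : X}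
    (hhk : ∀ a, |(hist x a : ℝ) - hist x' a| ≤ τ)
    (hΔ : {a | hist x a ≠ hist x' a}.ncard ≤ Δ) (hd : ∀ x, (hist x).support.card ≤ dbar)
    (hτT : τ < 2 * T) {α : ℝ} (hα : 1 < α) :
    renyiDiv α
      (((mechanism U dbar hτ hσ hT).comp hist).condLaw x (commonEvent dbar T (hist x) (hist x')))
      (((mechanism U dbar hτ hσ hT).comp hist).condLaw x' (commonEvent dbar T (hist x') (hist x)))
      ≤ ((α * (Δ / (2 * σ ^ 2)) : ℝ) : EReal) := by
  classical
  set K := (hist x).support ∩ (hist x').support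
  have hK : ∀ a, a ∈ K ↔ hist x a ≠ 0 ∧ hist x' a ≠ 0 := fun a => by simp [K]
  rw [condLaw_mechanism_commonEvent hist hτ hσ hT hK hhk (hd x) hτT,
    condLaw_mechanism_commonEvent hist hτ hσ hT (fun a => (hK a).trans and_comm)
      (fun a => abs_sub_comm (hist x a : ℝ) _ ▸ hhk a) (hd x') hτT]
  -- Both runs now have literally the same conditioning intervals.
  simp_rw [max_comm (hist x' _ : ℝ), min_comm (hist x' _ : ℝ)]
  have hv : (NNReal.mk ((τ * σ) ^ 2) (sq_nonneg _)) ≠ 0 := by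
    intro h
    have := congrArg NNReal.toReal h
    simp [hτ.ne', hσ.ne'] at this
  refine (renyiDiv_map_pi_cond_gaussianReal_le hv (fun a => ?_) (fun a => ?_)
    (measurable_releaseOn K _) hα).trans ?_
  · linarith [max_add_min (hist x a : ℝ) (hist x' a)]
  -- The interval has length `2 * T - |hist x a - hist x' a| ≥ 2 * T - τ > 0`.
  · have := max_sub_min_eq_abs (hist x a : ℝ) (hist x' a)
    rw [abs_sub_comm] at this
    linarith [hhk a]
  · rw [EReal.coe_le_coe_iff]
    gcongr
    rw [← Finset.sum_div, NNReal.coe_mk, div_le_div_iff₀ (by positivity) (by positivity)]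
    nlinarith [mul_le_mul_of_nonneg_right (sum_sq_sub_le hhk hΔ K)
      (by positivity : 0 ≤ 2 * σ ^ 2)]

end TruncGauss

end

/-! ### The privacy guarantee. -/

theorem mainTheorem8 {X U : Type*} (nbr : X → X → Prop) (hist : X → U →₀ ℕ)
    (Δ dbar : ℕ) (τ σ δ T : ℝ) (hτ : 0 < τ) (hσ : 0 < σ) (hT : 0 < T) (hδ : δ < Δ)
    (hdbar : ∀ x, (hist x).support.card ≤ dbar)
    (hL0 : HasL0Sensitivity nbr hist Δ) (hLInfty : HasLInftySensitivity nbr hist τ)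
    (hlevel : TruncGauss.IsTruncationLevel Δ τ σ δ T) :
    ((TruncGauss.mechanism U dbar hτ hσ hT).comp hist).IsApproxZCDP nbr δ 0
      (Δ / (2 * σ ^ 2)) := by
  have hs : 0 < τ * σ := mul_pos hτ hσ
  have hmono : Monotone stdNormalCDF := monotone_cdf _
  have hlt : -T / (τ * σ) < T / (τ * σ) := by
    rw [div_lt_div_iff_of_pos_right hs]; linarith
  have hcpos := sub_pos.mpr (stdNormalCDF_lt hlt)
  obtain ⟨q, hq⟩ : ∃ q, q = (stdNormalCDF (T / (τ * σ)) - stdNormalCDF ((τ - T) / (τ * σ))) /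
    (stdNormalCDF (T / (τ * σ)) - stdNormalCDF (-T / (τ * σ))) := ⟨_, rfl⟩
  rw [TruncGauss.IsTruncationLevel, ← hq] at hlevel
  -- `q ≤ 0` would give `δ = Δ * (1 - q) ≥ Δ`.
  have hq0 : 0 < q := by
    by_contra! hq0
    nlinarith [mul_nonneg (Nat.cast_nonneg (α := ℝ) Δ) (neg_nonneg.mpr hq0)]
  -- Positivity of `q` forces its numerator to be positive, so `τ - T < T`: the conditioning
  -- intervals are nondegenerate.
  have hτT : τ < 2 * T := by
    by_contra! h
    have : stdNormalCDF (T / (τ * σ)) ≤ stdNormalCDF ((τ - T) / (τ * σ)) :=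
      hmono (div_le_div_of_nonneg_right (by linarith) hs.le)
    exact absurd hq0 (not_lt.mpr (hq ▸ div_nonpos_of_nonpos_of_nonneg (by linarith) hcpos.le))
  have hq1 : q ≤ 1 := by
    rw [hq, div_le_one hcpos]
    have : stdNormalCDF (-T / (τ * σ)) ≤ stdNormalCDF ((τ - T) / (τ * σ)) :=
      hmono (div_le_div_of_nonneg_right (by linarith) hs.le)
    linarith
  -- Bernoulli's inequality, with `1 + Δ * (q - 1) = 1 - δ`.
  have hδq : ENNReal.ofReal (1 - δ) ≤ ENNReal.ofReal q ^ Δ := by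
    rw [← ENNReal.ofReal_pow hq0.le]
    refine ENNReal.ofReal_le_ofReal ?_
    have := one_add_mul_le_pow (a := q - 1) (by linarith) Δ
    rw [add_sub_cancel] at this
    linarith
  have hpos : ENNReal.ofReal q ^ Δ ≠ 0 := by simp [hq0]
  intro x x' hx
  have hL0' : {a | hist x' a ≠ hist x a}.ncard ≤ Δ := by
    simp_rw [ne_comm (a := hist x' _)]
    exact hL0 x x' hx
  have hLI := hLInfty x x' hx
  have hLI' : ∀ a, |(hist x' a : ℝ) - hist x a| ≤ τ := fun a => abs_sub_comm (hist x a : ℝ) _ ▸ hLI a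
  have hE := TruncGauss.le_prob_commonEvent (dbar := dbar) hτ hσ hT hLI (hL0 x x' hx) hτT.le hq hq1
  have hE' := TruncGauss.le_prob_commonEvent (dbar := dbar) hτ hσ hT hLI' hL0' hτT.le hq hq1
  refine ⟨TruncGauss.commonEvent dbar T (hist x) (hist x'),
    TruncGauss.commonEvent dbar T (hist x') (hist x),
    TruncGauss.measurableSet_commonEvent _ _ _ _, TruncGauss.measurableSet_commonEvent _ _ _ _,
    (hpos.bot_lt.trans_le hE).ne', (hpos.bot_lt.trans_le hE').ne',
    hδq.trans hE, hδq.trans hE', fun α hα => ?_⟩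
  rw [add_zero]
  exact ⟨TruncGauss.renyiDiv_condLaw_mechanism_le hist hτ hσ hT hLI (hL0 x x' hx) hdbar hτT hα,
    TruncGauss.renyiDiv_condLaw_mechanism_le hist hτ hσ hT hLI' hL0' hdbar hτT hα⟩
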